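/- **Setting.** A *simple polygon* $R$ is a non-crossing straight-line embedding of a cycle in the plane $\mathbb{R}^2$; it is also understood as the closed region it bounds. A *pointgon* $(R,P)$ is a simple polygon $R$ together with a finite point set $P$ consisting of the vertices of $R$ and possibly further points in the interior of $R$. A *pseudo-triangle* is a simple polygon with exactly three corners, a *corner* being a vertex whose interior angle is less than $\pi$; a vertex is *reflex* if this angle is greater than $\pi$ and *straight* if it equals $\pi$. A *pseudo-triangulation* $T$ of $(R,P)$ is a connected plane straight-line graph with vertex set exactly $P$, drawn in $R$ and containing the boundary edges of $R$, all of whose faces inside $R$ are pseudo-triangles. A vertex of $T$ is *$R$-pointed* if it is a reflex vertex of some face of $T$ in $R$, and *$R$-non-pointed* otherwise. A *lifting* of $T$ is a continuous function $f\colon R\to\mathbb{R}$ that restricts to an affine function on each closed face of $T$ in $R$; the *height* of a vertex $p$ in the lifting is $f(p)$. **Theorem (Surface Theorem).** Let $T$ be a pseudo-triangulation of a pointgon $(R,P)$ such that no vertex has a straight angle in a face of $T$ in $R$ (this holds in particular if $P$ is in general position, that is, no three points of $P$ are collinear). Then: 1. For every choice of real heights for the $R$-non-pointed vertices of $T$ there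 is a unique lifting of $T$ that has these heights. 2. The height of every $R$-pointed vertex is a linear function of the heights of the $R$-non-pointed vertices, with nonnegative coefficients: there are numbers $c_{p,w}\ge 0$, depending only on $T$, with $f(p)=\sum_{w} c_{p,w}\,f(w)$ for every lifting $f$ of $T$ and every $R$-pointed vertex $p$, where $w$ ranges over the $R$-non-pointed vertices. Consequently, the vector space of liftings of $T$ is finite-dimensional, and its dimension is the number of $R$-non-pointed vertices of $T$. -/

import Mathlib

open Set Filter Topology MeasureTheory

namespace PseudoTri

/-- The Euclidean plane. -/
abbrev Plane : Type := EuclideanSpace ℝ (Fin 2)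

/-! ### Simple polygons, the regions they bound, and angles -/

/-- A polygon is simple if it is a non-crossing straight-line embedding of a cycle: there are at
least three vertices, they are distinct, no vertex lies in the relative interior of an edge, and
distinct edges have disjoint relative interiors. The `i`-th edge joins the vertex `i` to the
cyclically next vertex `finRotate n i`. -/
structure IsSimple {n : ℕ} (C : Polygon Plane n) : Prop where
  three_le : 3 ≤ n
  injective : Function.Injective C.vertices
  vertex_notMem_edge : ∀ i j : Fin n, C j ∉ openSegment ℝ (C i) (C (finRotate n i))
  edges_disjoint : ∀ i j : Fin n, i ≠ j →
    Disjoint (openSegment ℝ (C i) (C (finRotate n i))) (openSegment ℝ (C j) (C (finRotate n j)))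

/-- `U` is the (open) interior region of the polygon `C`: a bounded, connected open set whose
topological boundary is the closed polygonal curve `C`. For a simple polygon there is exactly one
such set, the bounded component of the complement of the curve. -/
structure IsInterior {n : ℕ} (C : Polygon Plane n) (U : Set Plane) : Prop where
  isOpen : IsOpen U
  isConnected : IsConnected U
  isBounded : Bornology.IsBounded U
  frontier_eq : frontier U = C.boundary ℝ

/-- The angle at the point `v` facing the planar region `U`: the total measure of the directions
`θ` in `[0, 2π)` along which one enters `U` when leaving `v`. If `v` is a vertex of a simple
polygon with interior `U`, this is the interior angle of the polygon at `v`. -/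
noncomputable def angleAt (U : Set Plane) (v : Plane) : ENNReal :=
  volume {θ : ℝ | θ ∈ Ico 0 (2 * Real.pi) ∧
    ∀ᶠ t : ℝ in 𝓝[>] 0, v + t • (!₂[Real.cos θ, Real.sin θ] : Plane) ∈ U}

/-- The angle at `v` facing `U` is convex (then `v` is a corner of `U`). -/
def IsConvexAngle (U : Set Plane) (v : Plane) : Prop :=
  angleAt U v < ENNReal.ofReal Real.pi

/-- The angle at `v` facing `U` is straight. -/
def IsStraightAngle (U : Set Plane) (v : Plane) : Prop :=
  angleAt U v = ENNReal.ofReal Real.pi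

/-- The angle at `v` facing `U` is reflex. -/
def IsReflexAngle (U : Set Plane) (v : Plane) : Prop :=
  ENNReal.ofReal Real.pi < angleAt U v

/-! ### Geometric graphs -/

section Graph

variable {P : Finset Plane}

/-- The straight-line drawing of a graph `G` whose vertices are points of the plane. -/
def drawing (G : SimpleGraph P) : Set Plane :=
  (P : Set Plane) ∪ ⋃ (u : P) (v : P) (_ : G.Adj u v), segment ℝ (u : Plane) (v : Plane)

/-- A geometric graph is plane (non-crossing) if no vertex lies in the relative interior of an edge
and the relative interiors of distinct edges are disjoint. -/
structure IsPlane (G : SimpleGraph P) : Prop where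
  vertex_notMem_edge : ∀ u v w : P, G.Adj u v → (w : Plane) ∉ openSegment ℝ (u : Plane) v
  edges_disjoint : ∀ u v u' v' : P, G.Adj u v → G.Adj u' v' → s(u, v) ≠ s(u', v') →
    Disjoint (openSegment ℝ (u : Plane) v) (openSegment ℝ (u' : Plane) v')

/-- The (open) faces of the geometric graph `G` that meet the set `U`, where the faces are the
connected components of the complement of the drawing. -/
def facesIn (G : SimpleGraph P) (U : Set Plane) : Set (Set Plane) :=
  {F | ∃ x ∈ U \ drawing G, F = connectedComponentIn (drawing G)ᶜ x}

/-- The face `F` of `G` is a pseudo-triangle: it is the interior of a simple polygon that is a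
cycle of `G`, and it has exactly three corners (convex vertices). -/
def IsPseudoTriangle (G : SimpleGraph P) (F : Set Plane) : Prop :=
  ∃ (n : ℕ) (q : Fin n → P),
    (∀ i, G.Adj (q i) (q (finRotate n i))) ∧
    IsSimple (⟨fun i => (q i : Plane)⟩ : Polygon Plane n) ∧
    IsInterior (⟨fun i => (q i : Plane)⟩ : Polygon Plane n) F ∧
    {i : Fin n | IsConvexAngle F (q i)}.ncard = 3

end Graph

/-! ### Pointgons and their pseudo-triangulations -/

/-- A pointgon: a simple polygon `R` with a finite set of points consisting of the vertices of `R`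
and possibly additional points in the interior of `R`. -/
structure Pointgon where
  /-- the number of vertices of the polygon -/
  size : ℕ
  /-- the polygon `R` -/
  polygon : Polygon Plane size
  isSimple : IsSimple polygon
  /-- the open region enclosed by `R` -/
  interior : Set Plane
  isInterior : IsInterior polygon interior
  /-- the point set `P` -/
  points : Finset Plane
  vertex_mem : ∀ i, polygon i ∈ points
  mem_vertices_or_interior : ∀ p ∈ points, p ∈ range polygon.vertices ∨ p ∈ interior

namespace Pointgon

variable (Q : Pointgon)

/-- The polygon `R` understood as a closed region of the plane. -/
def region : Set Plane := closure Q.interior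

theorem mem_region {p : Plane} (hp : p ∈ Q.points) : p ∈ Q.region := by
  rcases Q.mem_vertices_or_interior p hp with ⟨i, rfl⟩ | h
  · refine frontier_subset_closure ?_
    rw [Q.isInterior.frontier_eq]
    exact mem_iUnion.2 ⟨i, left_mem_affineSegment ℝ _ _⟩
  · exact subset_closure h

/-- A point of the pointgon as a point of its region. -/
def toRegion (p : Q.points) : Q.region := ⟨p, Q.mem_region p.2⟩

end Pointgon

/-- A pseudo-triangulation of a pointgon `(R, P)`: a connected plane straight-line graph with vertex
set `P`, drawn in the region `R` and containing the boundary edges of `R`, all of whose faces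
in `R` are pseudo-triangles. -/
structure PseudoTriangulation (Q : Pointgon) where
  /-- the underlying graph -/
  graph : SimpleGraph Q.points
  isPlane : IsPlane graph
  connected : graph.Connected
  boundary_adj : ∀ i : Fin Q.size,
    graph.Adj ⟨Q.polygon i, Q.vertex_mem i⟩
      ⟨Q.polygon (finRotate Q.size i), Q.vertex_mem (finRotate Q.size i)⟩
  edge_subset : ∀ u v : Q.points, graph.Adj u v → segment ℝ (u : Plane) v ⊆ Q.region
  isPseudoTriangle : ∀ F ∈ facesIn graph Q.interior, IsPseudoTriangle graph F

namespace PseudoTriangulation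

variable {Q : Pointgon} (T : PseudoTriangulation Q)

/-- The pseudo-triangles of `T` (as open regions). -/
def faces : Set (Set Plane) := facesIn T.graph Q.interior

/-- No vertex has a straight angle in a pseudo-triangle of `T`. -/
def NoStraightAngles : Prop :=
  ∀ F ∈ T.faces, ∀ p : Q.points, ¬ IsStraightAngle F p

/-- A vertex is `R`-pointed if it is a reflex vertex of some face of `T` in `R`. -/
def IsRPointed (p : Q.points) : Prop := ∃ F ∈ T.faces, IsReflexAngle F p

/-- The type of `R`-pointed vertices. -/
def RPointed : Type := {p : Q.points // T.IsRPointed p}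

/-- The type of `R`-non-pointed vertices. -/
def RNonPointed : Type := {p : Q.points // ¬ T.IsRPointed p}

noncomputable instance : Fintype T.RNonPointed :=
  @Fintype.ofFinite _ (inferInstanceAs (Finite {p : Q.points // ¬ T.IsRPointed p}))

/-- The point of the region `R` at an `R`-pointed vertex. -/
def RPointed.pt {T : PseudoTriangulation Q} (p : T.RPointed) : Q.region := Q.toRegion p.1

/-- The point of the region `R` at an `R`-non-pointed vertex. -/
def RNonPointed.pt {T : PseudoTriangulation Q} (p : T.RNonPointed) : Q.region := Q.toRegion p.1

/-- A lifting of `T`: a continuous function on the closed region `R` that restricts to an affine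
function on each (closed) face of `T`. -/
def IsLifting (f : Q.region → ℝ) : Prop :=
  Continuous f ∧ ∀ F ∈ T.faces, ∃ A : Plane →ᵃ[ℝ] ℝ, ∀ x : Q.region, (x : Plane) ∈ closure F →
    f x = A x

/-- The real vector space of liftings of `T`. -/
def liftings : Submodule ℝ (Q.region → ℝ) where
  carrier := {f | T.IsLifting f}
  zero_mem' := ⟨continuous_const, fun _ _ => ⟨0, fun _ _ => rfl⟩⟩
  add_mem' := by
    rintro f g ⟨hf, hf'⟩ ⟨hg, hg'⟩
    refine ⟨hf.add hg, fun F hF => ?_⟩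
    obtain ⟨A, hA⟩ := hf' F hF
    obtain ⟨B, hB⟩ := hg' F hF
    exact ⟨A + B, fun x hx => by simp [hA x hx, hB x hx]⟩
  smul_mem' := by
    rintro c f ⟨hf, hf'⟩
    refine ⟨hf.const_smul c, fun F hF => ?_⟩
    obtain ⟨A, hA⟩ := hf' F hF
    exact ⟨c • A, fun x hx => by simp [hA x hx]⟩

end PseudoTriangulation

end PseudoTri

/-! A region bounded by a polygon faces every extreme point of its vertices' hull with a convex
angle, so by Krein–Milman a pseudo-triangle lies in the triangle spanned by its three corners. That
triangle is nondegenerate, since the face is open and nonempty. Hence an affine function on a face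
is the same as a free choice of three corner heights. With straight angles excluded, every other
vertex of the face is reflex there and is a convex combination of the corners.

Angles at a vertex add up to at most 2π, so each pointed vertex p is reflex in exactly one face.
This gives one equation h(p) = ∑ μ(p,q) h(q) per pointed vertex, with nonnegative weights of sum 1
on the corners of that face. Heights satisfying these equations ("harmonic" heights) are exactly the
vertex heights of liftings: the affine pieces then take the right value at all vertices, and two
closed faces meet only in vertices and common edges, so the pieces glue
(`IsCornerAveraging.harmonic_of_isLifting`, `IsCornerAveraging.exists_isLifting`).

What remains is a Dirichlet problem whose boundary is the set of non-pointed vertices. The maximum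
principle `IsAveraging.nonpos` uses the geometry: among the maximisers of h, one farthest from the
origin is not a nontrivial convex combination of maximisers, so it cannot be pointed if the maximum
exceeds the boundary values. Uniqueness follows, existence by finite-dimensional linear algebra, and
nonnegativity of the coefficients from the harmonic extensions of indicators. -/

namespace PseudoTri

/-! ### Directions and angles -/

/-- The unit vector in direction `θ`. -/
noncomputable def unitDir (θ : ℝ) : Plane := !₂[Real.cos θ, Real.sin θ]

theorem continuous_unitDir : Continuous unitDir := by
  unfold unitDir
  fun_prop

theorem norm_unitDir (θ : ℝ) : ‖unitDir θ‖ = 1 := by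
  simp [unitDir, EuclideanSpace.norm_eq]

/-- In the period centred at `φ` the condition cuts out at most an interval of radius `arccos c`,
which is less than π/2. Centring the period avoids a case split on wrap-around. -/
theorem volume_lt_pi_of_le_cos (φ : ℝ) {c : ℝ} (hc : 0 < c) :
    volume {θ : ℝ | θ ∈ Ico 0 (2 * Real.pi) ∧ c ≤ Real.cos (θ - φ)} < ENNReal.ofReal Real.pi := by
  have hT : 0 < 2 * Real.pi := Real.two_pi_pos
  set A : Set ℝ := {θ | c ≤ Real.cos (θ - φ)} with hA
  have hAm : MeasurableSet A := by
    refine (isClosed_le continuous_const ?_).measurableSet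
    fun_prop
  have hinv : ∀ g : AddSubgroup.zmultiples (2 * Real.pi), (fun x => g +ᵥ x) ⁻¹' A = A := by
    rintro ⟨_, k, rfl⟩
    ext x
    have : k * (2 * Real.pi) + x - φ = x - φ + k * (2 * Real.pi) := by ring
    simp [hA, AddSubgroup.vadd_def, this, Real.cos_add_int_mul_two_pi]
  -- A periodic set has the same measure in every period.
  have key := (isAddFundamentalDomain_Ioc hT 0).measure_set_eq
    (isAddFundamentalDomain_Ioc hT (φ - Real.pi)) hAm hinv
  have h1 : {θ : ℝ | θ ∈ Ico 0 (2 * Real.pi) ∧ c ≤ Real.cos (θ - φ)} ⊆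
      (A ∩ Ioc 0 (0 + 2 * Real.pi)) ∪ {0} := by
    rintro θ ⟨h, h'⟩
    rcases h.1.eq_or_lt with h0 | h0
    · exact Or.inr h0.symm
    · exact Or.inl ⟨h', h0, by linarith [h.2]⟩
  have h2 : A ∩ Ioc (φ - Real.pi) (φ - Real.pi + 2 * Real.pi) ⊆
      Icc (φ - Real.arccos c) (φ + Real.arccos c) := by
    rintro θ ⟨h, h', h''⟩
    have hab : |θ - φ| ≤ Real.pi := abs_le.2 ⟨by linarith, by linarith⟩
    have h3 : |θ - φ| ≤ Real.arccos c := by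
      rw [← Real.arccos_cos (abs_nonneg (θ - φ)) hab, Real.cos_abs]
      exact Real.antitone_arccos h
    have := abs_le.1 h3
    exact ⟨by linarith, by linarith⟩
  calc volume {θ : ℝ | θ ∈ Ico 0 (2 * Real.pi) ∧ c ≤ Real.cos (θ - φ)}
      ≤ volume (A ∩ Ioc 0 (0 + 2 * Real.pi)) + volume {(0 : ℝ)} :=
        (measure_mono h1).trans (measure_union_le _ _)
    _ = volume (A ∩ Ioc (φ - Real.pi) (φ - Real.pi + 2 * Real.pi)) := by
        rw [key, measure_singleton, add_zero]
    _ ≤ volume (Icc (φ - Real.arccos c) (φ + Real.arccos c)) := measure_mono h2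
    _ = ENNReal.ofReal (2 * Real.arccos c) := by rw [Real.volume_Icc]; congr 1; ring
    _ < ENNReal.ofReal Real.pi := by
        refine (ENNReal.ofReal_lt_ofReal_iff Real.pi_pos).2 ?_
        linarith [Real.arccos_lt_pi_div_two.2 hc]

/-- The amplitude and phase are the polar coordinates of the complex number formed by the
coefficients of `f`. -/
theorem exists_unitDir_eq_mul_cos (f : Plane →L[ℝ] ℝ) :
    ∃ r φ : ℝ, 0 ≤ r ∧ ∀ θ, f (unitDir θ) = r * Real.cos (θ - φ) := by
  set z : ℂ := ⟨f !₂[1, 0], f !₂[0, 1]⟩ with hz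
  refine ⟨‖z‖, z.arg, norm_nonneg z, fun θ => ?_⟩
  have h : unitDir θ = Real.cos θ • (!₂[1, 0] : Plane) + Real.sin θ • (!₂[0, 1] : Plane) := by
    ext i
    fin_cases i <;> simp [unitDir]
  rw [h, map_add, map_smul, map_smul, Real.cos_sub]
  have h1 := Complex.norm_mul_cos_arg z
  have h2 := Complex.norm_mul_sin_arg z
  simp only [hz] at h1 h2 ⊢
  simp only [smul_eq_mul]
  linear_combination -Real.cos θ * h1 - Real.sin θ * h2

theorem volume_lt_pi_of_le_clm (f : Plane →L[ℝ] ℝ) {c : ℝ} (hc : 0 < c) :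
    volume {θ : ℝ | θ ∈ Ico 0 (2 * Real.pi) ∧ c ≤ f (unitDir θ)} < ENNReal.ofReal Real.pi := by
  obtain ⟨r, φ, hr, h⟩ := exists_unitDir_eq_mul_cos f
  rcases hr.eq_or_lt with rfl | hr
  · simp [h, hc.not_ge, Real.pi_pos]
  · refine (measure_mono ?_).trans_lt (volume_lt_pi_of_le_cos φ (div_pos hc hr))
    rintro θ ⟨h1, h2⟩
    refine ⟨h1, ?_⟩
    rw [h] at h2
    rwa [div_le_iff₀' hr]

theorem isCompact_convexHull_of_finite {s : Set Plane} (hs : s.Finite) :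
    IsCompact (convexHull ℝ s) :=
  hs.isCompact_convexHull ℝ

theorem isClosed_convexHull_of_finite {s : Set Plane} (hs : s.Finite) :
    IsClosed (convexHull ℝ s) :=
  (isCompact_convexHull_of_finite hs).isClosed

/-- A region inside the convex hull of a finite set faces an extreme point of that hull with a
convex angle. -/
theorem isConvexAngle_of_mem_extremePoints {U s : Set Plane} (hs : s.Finite)
    (hU : U ⊆ convexHull ℝ s) {v : Plane} (hv : v ∈ (convexHull ℝ s).extremePoints ℝ) :
    IsConvexAngle U v := by
  -- Deleting an extreme point leaves the hull convex, so `v` can be strictly separated from the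
  -- other points.
  have hvK : v ∉ convexHull ℝ (s \ {v}) := by
    have hconv : Convex ℝ (convexHull ℝ s \ {v}) :=
      ((convex_convexHull ℝ s).mem_extremePoints_iff_convex_sdiff.1 hv).2
    intro h
    exact (convexHull_min (sdiff_subset_sdiff_left (subset_convexHull ℝ s)) hconv h).2 rfl
  obtain ⟨f, u, hfv, hfu⟩ := geometric_hahn_banach_point_closed (convex_convexHull ℝ (s \ {v}))
    (isClosed_convexHull_of_finite hs.sdiff) hvK
  obtain ⟨D, hD0, hD⟩ : ∃ D : ℝ, 0 < D ∧ ∀ w ∈ s, ‖w - v‖ ≤ D := by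
    obtain ⟨D, hD⟩ := (hs.image fun w => ‖w - v‖).bddAbove
    exact ⟨max D 1, by positivity, fun w hw => (hD ⟨w, hw, rfl⟩).trans (le_max_left _ _)⟩
  -- The separation gap over the radius `D`: with this slope all of `s`, hence its hull, lies in the
  -- convex cone `ε * ‖x - v‖ ≤ f (x - v)`.
  set ε := (u - f v) / D with hε
  have hε0 : 0 < ε := div_pos (sub_pos.2 hfv) hD0
  have hcone : convexHull ℝ s ⊆ {x | ε * ‖x - v‖ ≤ f (x - v)} := by
    refine convexHull_min (fun w hw => ?_) ?_
    · by_cases hwv : w = v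
      · simp [hwv]
      · have h1 := hfu w (subset_convexHull ℝ _ ⟨hw, hwv⟩)
        have h2 : ε * ‖w - v‖ ≤ ε * D := by gcongr; exact hD w hw
        have h3 : ε * D = u - f v := by rw [hε]; field_simp
        show ε * ‖w - v‖ ≤ f (w - v)
        rw [map_sub]
        linarith
    · intro x hx y hy a b ha hb hab
      have h1 : a • x + b • y - v = a • (x - v) + b • (y - v) := by
        rw [smul_sub, smul_sub, sub_add_sub_comm, ← add_smul, hab, one_smul]
      show ε * ‖a • x + b • y - v‖ ≤ f (a • x + b • y - v)
      rw [h1, map_add, map_smul, map_smul, smul_eq_mul, smul_eq_mul]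
      calc ε * ‖a • (x - v) + b • (y - v)‖ ≤ ε * (a * ‖x - v‖ + b * ‖y - v‖) := by
            gcongr
            refine (norm_add_le _ _).trans_eq ?_
            rw [norm_smul, norm_smul, Real.norm_of_nonneg ha, Real.norm_of_nonneg hb]
        _ = a * (ε * ‖x - v‖) + b * (ε * ‖y - v‖) := by ring
        _ ≤ _ := by
            gcongr
            · exact hx
            · exact hy
  refine (measure_mono ?_).trans_lt (volume_lt_pi_of_le_clm f hε0)
  rintro θ ⟨hθ, hev⟩
  refine ⟨hθ, ?_⟩
  obtain ⟨t, ht, ht0⟩ := (hev.and self_mem_nhdsWithin).exists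
  have h := hcone (hU ht)
  change 0 < t at ht0
  change ε * ‖v + t • unitDir θ - v‖ ≤ f (v + t • unitDir θ - v) at h
  rw [add_sub_cancel_left, norm_smul, norm_unitDir, map_smul, Real.norm_of_nonneg ht0.le,
    smul_eq_mul] at h
  exact le_of_mul_le_mul_left (by linarith) ht0

/-- A bounded open set is contained in every closed convex set that contains its frontier. -/
theorem subset_of_frontier_subset {U K : Set Plane} (hU : IsOpen U) (hb : Bornology.IsBounded U)
    (hK : Convex ℝ K) (hKc : IsClosed K) (hne : K.Nonempty) (h : frontier U ⊆ K) : U ⊆ K := by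
  intro x hx
  by_contra hxK
  obtain ⟨f, u, hfx, hfu⟩ := geometric_hahn_banach_point_closed hK hKc hxK
  -- The minimum of `f` over the closure is not attained on the frontier, where `f > u`. An interior
  -- minimum forces the linear functional `f` to vanish, contradicting separation.
  obtain ⟨x₀, hx₀, hmin⟩ := hb.isCompact_closure.exists_isMinOn ⟨x, subset_closure hx⟩
    f.continuous.continuousOn
  have hx₀U : x₀ ∈ U := by
    by_contra hn
    have h1 : x₀ ∈ K := h ⟨hx₀, by rwa [hU.interior_eq]⟩
    have h2 : f x₀ ≤ f x := hmin (subset_closure hx)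
    linarith [hfu x₀ h1]
  have hloc : IsLocalMin f x₀ := hmin.isLocalMin (mem_of_superset (hU.mem_nhds hx₀U) subset_closure)
  have hf0 : f = 0 := by simpa using hloc.fderiv_eq_zero
  obtain ⟨y, hy⟩ := hne
  have := hfu y hy
  simp [hf0] at this hfx
  linarith

/-! ### Pseudo-triangles -/

theorem boundary_eq_iUnion_segment {n : ℕ} (C : Polygon Plane n) :
    C.boundary ℝ = ⋃ i, segment ℝ (C i) (C (finRotate n i)) := by
  simp [Polygon.boundary, Polygon.edgeSet, affineSegment_eq_segment]

theorem boundary_subset_convexHull {n : ℕ} (C : Polygon Plane n) :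
    C.boundary ℝ ⊆ convexHull ℝ (range C.vertices) := by
  rw [boundary_eq_iUnion_segment]
  exact iUnion_subset fun i => segment_subset_convexHull ⟨i, rfl⟩ ⟨_, rfl⟩

theorem IsInterior.subset_convexHull {n : ℕ} {C : Polygon Plane n} {U : Set Plane}
    (h : IsInterior C U) (hn : 0 < n) : U ⊆ convexHull ℝ (range C.vertices) :=
  subset_of_frontier_subset h.isOpen h.isBounded (convex_convexHull ℝ _)
    (isClosed_convexHull_of_finite (finite_range _))
    (convexHull_nonempty_iff.2 ⟨C ⟨0, hn⟩, mem_range_self _⟩)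
    (h.frontier_eq.trans_subset (boundary_subset_convexHull C))

/-- A polygonal region is contained in the convex hull of its corners. -/
theorem IsInterior.convexHull_corners {n : ℕ} {C : Polygon Plane n} {U : Set Plane}
    (h : IsInterior C U) (hn : 0 < n) :
    convexHull ℝ (range C.vertices) ⊆
      convexHull ℝ (C.vertices '' {i | IsConvexAngle U (C i)}) := by
  have hfin : (C.vertices '' {i | IsConvexAngle U (C i)}).Finite := (toFinite _).image _
  -- Krein–Milman reduces the claim to extreme points, which are vertices with a convex angle.
  rw [← closure_convexHull_extremePoints (isCompact_convexHull_of_finite (finite_range C.vertices))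
    (convex_convexHull ℝ _)]
  refine closure_minimal (convexHull_mono fun v hv => ?_) (isClosed_convexHull_of_finite hfin)
  obtain ⟨i, rfl⟩ := extremePoints_convexHull_subset hv
  exact ⟨i, isConvexAngle_of_mem_extremePoints (finite_range _) (h.subset_convexHull hn) hv, rfl⟩

/-! ### Drawings of plane graphs and their faces -/

section Drawings

variable {P : Finset Plane} {G : SimpleGraph P}

theorem mem_drawing_iff {x : Plane} :
    x ∈ drawing G ↔ x ∈ P ∨ ∃ u v : P, G.Adj u v ∧ x ∈ segment ℝ (u : Plane) v := by
  simp [drawing]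

theorem isClosed_segment (x y : Plane) : IsClosed (segment ℝ x y) := by
  rw [← convexHull_pair]
  exact isClosed_convexHull_of_finite (toFinite {x, y})

theorem isClosed_drawing : IsClosed (drawing G) :=
  P.finite_toSet.isClosed.union <| isClosed_iUnion_of_finite fun u =>
    isClosed_iUnion_of_finite fun v => isClosed_iUnion_of_finite fun _ => isClosed_segment u v

theorem volume_segment (x y : Plane) : volume (segment ℝ x y) = 0 := by
  have hsub : segment ℝ x y ⊆ (line[ℝ, x, y] : Set Plane) := by
    rw [← convexHull_pair]
    exact convexHull_subset_affineSpan _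
  refine measure_mono_null hsub (Measure.addHaar_affineSubspace _ _ fun h => ?_)
  have h1 : Module.finrank ℝ (vectorSpan ℝ ({x, y} : Set Plane)) ≤ 1 :=
    (collinear_pair ℝ x y).finrank_le_one
  rw [← direction_affineSpan, h, AffineSubspace.direction_top, finrank_top] at h1
  simp at h1

/-- The drawing is a finite union of points and segments, hence a null set. -/
theorem dense_compl_drawing : Dense (drawing G)ᶜ := by
  have h0 : volume (drawing G) = 0 := by
    refine measure_union_null (P.finite_toSet.measure_zero _) ?_
    refine measure_iUnion_null fun u => measure_iUnion_null fun v => measure_iUnion_null fun _ => ?_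
    exact volume_segment _ _
  exact interior_eq_empty_iff_dense_compl.1 (Measure.interior_eq_empty_of_null h0)

variable {U F F' : Set Plane}

theorem isOpen_of_mem_facesIn (hF : F ∈ facesIn G U) : IsOpen F := by
  obtain ⟨x, -, rfl⟩ := hF
  exact isClosed_drawing.isOpen_compl.connectedComponentIn

theorem subset_compl_drawing_of_mem_facesIn (hF : F ∈ facesIn G U) : F ⊆ (drawing G)ᶜ := by
  obtain ⟨x, -, rfl⟩ := hF
  exact connectedComponentIn_subset _ _

theorem eq_connectedComponentIn_of_mem_facesIn (hF : F ∈ facesIn G U) {y : Plane} (hy : y ∈ F) :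
    F = connectedComponentIn (drawing G)ᶜ y := by
  obtain ⟨x, -, rfl⟩ := hF
  exact connectedComponentIn_eq hy

/-- Maximality of components; it serves to keep short ray pieces and half discs inside one face. -/
theorem subset_of_mem_facesIn (hF : F ∈ facesIn G U) {S : Set Plane} (hS : IsPreconnected S)
    (hSd : S ⊆ (drawing G)ᶜ) {y : Plane} (hyS : y ∈ S) (hy : y ∈ F) : S ⊆ F := by
  rw [eq_connectedComponentIn_of_mem_facesIn hF hy]
  exact hS.subset_connectedComponentIn hyS hSd

theorem disjoint_of_mem_facesIn (hF : F ∈ facesIn G U) (hF' : F' ∈ facesIn G U) (hne : F ≠ F') :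
    Disjoint F F' :=
  Set.disjoint_left.2 fun _ hy hy' => hne <|
    (eq_connectedComponentIn_of_mem_facesIn hF hy).trans
      (eq_connectedComponentIn_of_mem_facesIn hF' hy').symm

theorem mem_frontier_of_mem_drawing (hF : F ∈ facesIn G U) {x : Plane} (hx : x ∈ drawing G)
    (hxF : x ∈ closure F) : x ∈ frontier F :=
  ⟨hxF, fun h => subset_compl_drawing_of_mem_facesIn hF (interior_subset h) hx⟩

theorem mem_frontier_of_mem_closure_inter (hF : F ∈ facesIn G U) (hF' : F' ∈ facesIn G U)
    (hne : F ≠ F') {x : Plane} (hx : x ∈ closure F) (hx' : x ∈ closure F') : x ∈ frontier F := by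
  refine ⟨hx, fun h => ?_⟩
  obtain ⟨y, hy, hy'⟩ := mem_closure_iff.1 hx' _ isOpen_interior h
  exact Set.disjoint_left.1 (disjoint_of_mem_facesIn hF hF' hne) (interior_subset hy) hy'

theorem mem_vertices_of_mem_segment (hG : IsPlane G) {u v w : P} (h : G.Adj u v)
    (hw : (w : Plane) ∈ segment ℝ (u : Plane) v) : w = u ∨ w = v := by
  rw [← insert_endpoints_openSegment] at hw
  rcases hw with h1 | h1 | h1
  · exact Or.inl (Subtype.ext h1)
  · exact Or.inr (Subtype.ext h1)
  · exact (hG.vertex_notMem_edge u v w h h1).elim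

/-- The part of the drawing consisting of the vertices and edges singled out by `p` and `q`. -/
theorem isClosed_partialDrawing (p : P → Prop) (q : P → P → Prop) :
    IsClosed ({x : Plane | ∃ w : P, p w ∧ x = w} ∪
      {x : Plane | ∃ u v : P, q u v ∧ x ∈ segment ℝ (u : Plane) v}) := by
  refine IsClosed.union (Set.Finite.isClosed ?_) ?_
  · refine P.finite_toSet.subset ?_
    rintro _ ⟨w, -, rfl⟩
    exact w.2
  · have : {x : Plane | ∃ u v : P, q u v ∧ x ∈ segment ℝ (u : Plane) v} =
        ⋃ (u : P) (v : P) (_ : q u v), segment ℝ (u : Plane) v := by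
      ext x; simp
    rw [this]
    exact isClosed_iUnion_of_finite fun u => isClosed_iUnion_of_finite fun v =>
      isClosed_iUnion_of_finite fun _ => isClosed_segment u v

/-- Around a point in the relative interior of an edge, the drawing is contained in that edge. -/
theorem exists_ball_inter_drawing_edge (hG : IsPlane G) {u v : P} (huv : G.Adj u v) {m : Plane}
    (hm : m ∈ openSegment ℝ (u : Plane) v) :
    ∃ r > 0, ∀ x ∈ Metric.ball m r, x ∈ drawing G → x ∈ segment ℝ (u : Plane) v := by
  set D : Set Plane := {x : Plane | ∃ w : P, True ∧ x = w} ∪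
      {x : Plane | ∃ a b : P, (G.Adj a b ∧ s(u, v) ≠ s(a, b)) ∧ x ∈ segment ℝ (a : Plane) b} with hD
  have hDc : IsClosed D := isClosed_partialDrawing _ _
  have hmP : ∀ w : P, m ≠ w := by
    rintro w rfl
    exact hG.vertex_notMem_edge u v w huv hm
  have hmD : m ∉ D := by
    rintro (⟨w, -, h⟩ | ⟨a, b, ⟨hab, hne⟩, h⟩)
    · exact hmP w h
    · rw [← insert_endpoints_openSegment] at h
      rcases h with h1 | h1 | h1
      · exact hmP a h1
      · exact hmP b h1
      · exact Set.disjoint_left.1 (hG.edges_disjoint u v a b huv hab hne) hm h1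
  obtain ⟨r, hr, hball⟩ := Metric.isOpen_iff.1 hDc.isOpen_compl m hmD
  refine ⟨r, hr, fun x hx hxd => ?_⟩
  rcases mem_drawing_iff.1 hxd with h | ⟨a, b, hab, h⟩
  · exact (hball hx (Or.inl ⟨⟨x, h⟩, trivial, rfl⟩)).elim
  · by_cases hne : s(u, v) = s(a, b)
    · rcases Sym2.eq_iff.1 hne with ⟨rfl, rfl⟩ | ⟨rfl, rfl⟩
      · exact h
      · rwa [segment_symm]
    · exact (hball hx (Or.inr ⟨a, b, ⟨hab, hne⟩, h⟩)).elim

/-- Around a vertex, the drawing is contained in the union of the edges at that vertex, and all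
other vertices are at distance at least `r`. -/
theorem exists_ball_inter_drawing_vertex (hG : IsPlane G) (p : P) :
    ∃ r > 0, (∀ w : P, w ≠ p → r ≤ ‖(w : Plane) - p‖) ∧ ∀ x ∈ Metric.ball (p : Plane) r,
      x ∈ drawing G → x ≠ p → ∃ w : P, G.Adj p w ∧ x ∈ segment ℝ (p : Plane) w := by
  set D : Set Plane := {x : Plane | ∃ w : P, w ≠ p ∧ x = w} ∪
      {x : Plane | ∃ a b : P, (G.Adj a b ∧ p ≠ a ∧ p ≠ b) ∧ x ∈ segment ℝ (a : Plane) b} with hD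
  have hDc : IsClosed D := isClosed_partialDrawing _ _
  have hpD : (p : Plane) ∉ D := by
    rintro (⟨w, hw, h⟩ | ⟨a, b, ⟨hab, ha, hb⟩, h⟩)
    · exact hw (Subtype.ext h.symm)
    · exact (mem_vertices_of_mem_segment hG hab h).elim ha hb
  obtain ⟨r, hr, hball⟩ := Metric.isOpen_iff.1 hDc.isOpen_compl _ hpD
  refine ⟨r, hr, fun w hw => ?_, fun x hx hxd hxp => ?_⟩
  · by_contra! hlt
    exact hball (mem_ball_iff_norm.2 hlt) (Or.inl ⟨w, hw, rfl⟩)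
  · rcases mem_drawing_iff.1 hxd with h | ⟨a, b, hab, h⟩
    · exact (hball hx (Or.inl ⟨⟨x, h⟩, fun h' => hxp (congrArg Subtype.val h'), rfl⟩)).elim
    · by_cases ha : p = a
      · subst ha
        exact ⟨b, hab, h⟩
      by_cases hb : p = b
      · subst hb
        exact ⟨a, hab.symm, by rwa [segment_symm]⟩
      · exact (hball hx (Or.inr ⟨a, b, ⟨hab, ha, hb⟩, h⟩)).elim

/-! ### Angles of faces at vertices -/

/-- The directions along which one enters a face when leaving a vertex form an open set. -/
theorem isOpen_setOf_enters_face (hG : IsPlane G) (hF : F ∈ facesIn G U) (p : P) :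
    IsOpen {θ : ℝ | ∀ᶠ t : ℝ in 𝓝[>] 0, (p : Plane) + t • unitDir θ ∈ F} := by
  obtain ⟨r, hr, hfar, hball⟩ := exists_ball_inter_drawing_vertex hG p
  have hr2 : 0 < r / 2 := by positivity
  have hedge : ∀ (θ t : ℝ), 0 < t → t ≤ r / 2 → (p : Plane) + t • unitDir θ ∈ drawing G →
      ∃ w : P, G.Adj p w ∧ (p : Plane) + t • unitDir θ ∈ segment ℝ (p : Plane) w := by
    intro θ t ht htr hd
    have hn : ‖t • unitDir θ‖ = t := by
      rw [norm_smul, norm_unitDir, Real.norm_of_nonneg ht.le, mul_one]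
    refine hball _ ?_ hd ?_
    · rw [mem_ball_iff_norm, add_sub_cancel_left, hn]
      linarith
    · intro h
      rw [add_eq_left] at h
      rw [h, norm_zero] at hn
      exact ht.ne hn
  -- Near `p` the drawing is a star, so a short ray from `p` runs inside it or misses it.
  have hcross : ∀ (θ s t : ℝ), 0 < s → 0 < t → s ≤ r / 2 → t ≤ r / 2 →
      (p : Plane) + t • unitDir θ ∈ drawing G → (p : Plane) + s • unitDir θ ∈ drawing G := by
    intro θ s t hs ht hsr htr hd
    obtain ⟨w, hpw, hw⟩ := hedge θ t ht htr hd
    refine mem_drawing_iff.2 (Or.inr ⟨p, w, hpw, ?_⟩)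
    rw [segment_eq_image'] at hw ⊢
    obtain ⟨c, ⟨hc0, hc1⟩, hc⟩ := hw
    have hc' : c • ((w : Plane) - p) = t • unitDir θ := add_left_cancel hc
    have hnorm : c * ‖(w : Plane) - p‖ = t := by
      have := congrArg norm hc'
      rwa [norm_smul, norm_smul, norm_unitDir, Real.norm_of_nonneg hc0, Real.norm_of_nonneg ht.le,
        mul_one] at this
    -- The edge has length at least `r`, so rescaling to any `s ≤ r / 2` stays on it.
    have hcr : c * r ≤ t := by
      rw [← hnorm]
      gcongr
      exact hfar w hpw.ne'
    refine ⟨s / t * c, ⟨by positivity, ?_⟩, ?_⟩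
    · rw [div_mul_eq_mul_div, div_le_one ht]
      nlinarith
    · show (p : Plane) + (s / t * c) • ((w : Plane) - p) = _
      rw [mul_smul, hc', smul_smul, div_mul_cancel₀ _ ht.ne']
  have hiff : ∀ θ s t : ℝ, 0 < s → 0 < t → s ≤ r / 2 → t ≤ r / 2 →
      (p : Plane) + t • unitDir θ ∈ F → (p : Plane) + s • unitDir θ ∈ F := by
    intro θ s t hs ht hsr htr h
    have hpre : IsPreconnected ((fun a : ℝ => (p : Plane) + a • unitDir θ) '' Ioc 0 (r / 2)) :=
      isPreconnected_Ioc.image _ (by fun_prop)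
    refine subset_of_mem_facesIn hF hpre ?_ ⟨t, ⟨ht, htr⟩, rfl⟩ h ⟨s, ⟨hs, hsr⟩, rfl⟩
    rintro _ ⟨a, ⟨ha, har⟩, rfl⟩ had
    exact subset_compl_drawing_of_mem_facesIn hF h (hcross θ t a ht ha htr har had)
  -- Entering `F` is decided at the single radius `r / 2`, which makes the condition open in `θ`.
  have hset : {θ : ℝ | ∀ᶠ t : ℝ in 𝓝[>] 0, (p : Plane) + t • unitDir θ ∈ F} =
      {θ : ℝ | (p : Plane) + (r / 2) • unitDir θ ∈ F} := by
    ext θ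
    constructor
    · intro (h : ∀ᶠ t : ℝ in 𝓝[>] 0, (p : Plane) + t • unitDir θ ∈ F)
      obtain ⟨t, ht, ht0, htr⟩ := (h.and (Ioc_mem_nhdsGT hr2)).exists
      exact hiff θ _ t hr2 ht0 le_rfl htr ht
    · intro h
      filter_upwards [Ioc_mem_nhdsGT hr2] with t ht
      exact hiff θ t _ ht.1 hr2 ht.2 le_rfl h
  rw [hset]
  exact (isOpen_of_mem_facesIn hF).preimage
    (continuous_const.add (continuous_unitDir.const_smul (r / 2)))

/-- At each vertex, at most one face has a reflex angle. -/
theorem eq_of_isReflexAngle (hG : IsPlane G) (hF : F ∈ facesIn G U) (hF' : F' ∈ facesIn G U) (p : P)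
    (h : IsReflexAngle F p) (h' : IsReflexAngle F' p) : F = F' := by
  by_contra hne
  set A : Set Plane → Set ℝ := fun E => {θ : ℝ | θ ∈ Ico 0 (2 * Real.pi) ∧
    ∀ᶠ t : ℝ in 𝓝[>] 0, (p : Plane) + t • unitDir θ ∈ E} with hA
  have hdisj : Disjoint (A F) (A F') := by
    refine Set.disjoint_left.2 fun θ h1 h2 => ?_
    obtain ⟨t, ht1, ht2⟩ := (h1.2.and h2.2).exists
    exact Set.disjoint_left.1 (disjoint_of_mem_facesIn hF hF' hne) ht1 ht2
  have hmeas : MeasurableSet (A F') :=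
    measurableSet_Ico.inter (isOpen_setOf_enters_face hG hF' p).measurableSet
  have hsub : A F ∪ A F' ⊆ Ico 0 (2 * Real.pi) := union_subset (fun _ h => h.1) fun _ h => h.1
  have hle : volume (A F) + volume (A F') ≤ ENNReal.ofReal (2 * Real.pi) := by
    rw [← measure_union hdisj hmeas]
    refine (measure_mono hsub).trans_eq ?_
    rw [Real.volume_Ico, sub_zero]
  refine hle.not_gt ?_
  rw [two_mul, ENNReal.ofReal_add Real.pi_pos.le Real.pi_pos.le]
  exact ENNReal.add_lt_add h h'

/-- Away from the closure all short rays miss `F`, so the angle would be zero. -/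
theorem mem_closure_of_isReflexAngle {v : Plane} (h : IsReflexAngle F v) : v ∈ closure F := by
  by_contra hv
  have hev : ∀ᶠ x in 𝓝 v, x ∉ F := by
    filter_upwards [isClosed_closure.isOpen_compl.mem_nhds hv] with x hx hxF
    exact hx (subset_closure hxF)
  have hempty : angleAt F v = 0 := by
    refine measure_mono_null (t := ∅) ?_ measure_empty
    rintro θ ⟨-, hθ⟩
    have htend : Tendsto (fun t : ℝ => v + t • unitDir θ) (𝓝[>] 0) (𝓝 v) := by
      have : Continuous fun t : ℝ => v + t • unitDir θ := by fun_prop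
      simpa using (this.tendsto 0).mono_left nhdsWithin_le_nhds
    obtain ⟨t, ht1, ht2⟩ := (hθ.and (htend.eventually hev)).exists
    exact ht2 ht1
  rw [IsReflexAngle, hempty] at h
  exact not_lt_bot h

/-! ### Finiteness of the set of faces -/

/-- The faces having a given midpoint of an edge in their closure are finite in number. -/
theorem finite_facesIn_midpoint_mem_closure (hG : IsPlane G) {u v : P} (huv : G.Adj u v) :
    {F ∈ facesIn G U | midpoint ℝ (u : Plane) v ∈ closure F}.Finite := by
  have hne : (u : Plane) ≠ v := fun h => huv.ne (Subtype.ext h)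
  set m := midpoint ℝ (u : Plane) v with hm
  obtain ⟨r₀, hr₀, hball₀⟩ := exists_ball_inter_drawing_edge hG huv
    (midpoint_mem_openSegment (𝕜 := ℝ) (u : Plane) v)
  set d : Plane := v - u with hd
  have hd0 : 0 < ‖d‖ := norm_pos_iff.2 (sub_ne_zero.2 hne.symm)
  -- Within `‖d‖ / 2` of the midpoint, the line through the edge does not leave the edge.
  set r := min r₀ (‖d‖ / 2) with hr
  have hrpos : 0 < r := lt_min hr₀ (by positivity)
  -- The sign of `ℓ` tells the two sides of the edge apart. Each half disc avoids the drawing, so it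
  -- meets only one face.
  set ℓ : Plane → ℝ := fun x => d 0 * (x 1 - m 1) - d 1 * (x 0 - m 0) with hℓ
  have hdsq : d 0 ^ 2 + d 1 ^ 2 = ‖d‖ ^ 2 := by
    rw [EuclideanSpace.norm_sq_eq]; simp
  -- points of the edge lie on the line
  have hseg : ∀ x ∈ segment ℝ (u : Plane) v, ℓ x = 0 := by
    intro x hx
    rw [segment_eq_image'] at hx
    obtain ⟨c, -, rfl⟩ := hx
    simp [hℓ, hm, midpoint_eq_smul_add, hd]
    ring
  -- points of the line near the midpoint lie on the edge
  have hline : ∀ x ∈ Metric.ball m r, ℓ x = 0 → x ∈ drawing G := by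
    intro x hx hx0
    refine mem_drawing_iff.2 (Or.inr ⟨u, v, huv, ?_⟩)
    set c := (d 0 * (x 0 - m 0) + d 1 * (x 1 - m 1)) / ‖d‖ ^ 2 with hc
    have hxm : x - m = c • d := by
      have hc' : c * (d 0 ^ 2 + d 1 ^ 2) = d 0 * (x 0 - m 0) + d 1 * (x 1 - m 1) := by
        rw [hdsq, hc]; field_simp
      have hpos : 0 < d 0 ^ 2 + d 1 ^ 2 := by rw [hdsq]; positivity
      change d 0 * (x 1 - m 1) - d 1 * (x 0 - m 0) = 0 at hx0
      ext i
      apply mul_left_cancel₀ hpos.ne'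
      fin_cases i
      · show (d 0 ^ 2 + d 1 ^ 2) * (x 0 - m 0) = (d 0 ^ 2 + d 1 ^ 2) * (c * d 0)
        linear_combination -d 0 * hc' - d 1 * hx0
      · show (d 0 ^ 2 + d 1 ^ 2) * (x 1 - m 1) = (d 0 ^ 2 + d 1 ^ 2) * (c * d 1)
        linear_combination -d 1 * hc' + d 0 * hx0
    have hclt : |c| < 1 / 2 := by
      have h1 : ‖x - m‖ < ‖d‖ / 2 := (mem_ball_iff_norm.1 hx).trans_le (min_le_right _ _)
      rw [hxm, norm_smul, Real.norm_eq_abs] at h1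
      by_contra! h2
      nlinarith
    have hclt' := abs_lt.1 hclt
    rw [segment_eq_image']
    refine ⟨1 / 2 + c, ⟨by linarith, by linarith⟩, ?_⟩
    show (u : Plane) + (1 / 2 + c) • d = x
    rw [add_smul, ← hxm, hm, midpoint_eq_smul_add, hd]
    simp only [invOf_eq_inv]
    module
  have hmeet : ∀ F : {F ∈ facesIn G U | m ∈ closure F},
      ∃ y ∈ (F : Set Plane), y ∈ Metric.ball m r := by
    rintro ⟨F, hF, hmF⟩
    obtain ⟨y, hy, hyF⟩ := mem_closure_iff.1 hmF _ Metric.isOpen_ball (Metric.mem_ball_self hrpos)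
    exact ⟨y, hyF, hy⟩
  choose y hyF hyball using hmeet
  have hy0 : ∀ F, ℓ (y F) ≠ 0 := fun F h =>
    subset_compl_drawing_of_mem_facesIn F.2.1 (hyF F) (hline _ (hyball F) h)
  have hconv : ∀ ε : ℝ, IsPreconnected (Metric.ball m r ∩ {x | 0 < ε * ℓ x}) := by
    intro ε
    refine ((convex_ball m r).inter ?_).isPreconnected
    intro x hx z hz a b ha hb hab
    change 0 < ε * ℓ x at hx
    change 0 < ε * ℓ z at hz
    show 0 < ε * ℓ (a • x + b • z)
    have h1 : ℓ (a • x + b • z) = a * ℓ x + b * ℓ z := by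
      obtain rfl : b = 1 - a := by linarith
      simp [hℓ]
      ring
    rw [h1]
    rcases ha.eq_or_lt with rfl | ha'
    · obtain rfl : b = 1 := by linarith
      simpa using hz
    · nlinarith [mul_pos ha' hx, mul_nonneg hb hz.le]
  have hside : ∀ (ε : ℝ) F F', 0 < ε * ℓ (y F) → 0 < ε * ℓ (y F') → F = F' := by
    intro ε F F' h h'
    have hsub : Metric.ball m r ∩ {x | 0 < ε * ℓ x} ⊆ (drawing G)ᶜ := by
      rintro x ⟨hx, hx0⟩ hxd
      change 0 < ε * ℓ x at hx0
      rw [hseg x (hball₀ x (Metric.ball_subset_ball (min_le_left _ _) hx) hxd)] at hx0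
      simp at hx0
    have h1 := subset_of_mem_facesIn F.2.1 (hconv ε) hsub ⟨hyball F, h⟩ (hyF F) ⟨hyball F', h'⟩
    refine Subtype.ext ?_
    by_contra hne'
    exact Set.disjoint_left.1 (disjoint_of_mem_facesIn F.2.1 F'.2.1 hne') h1 (hyF F')
  have hinj : Function.Injective fun F => 0 < ℓ (y F) := by
    intro F F' h
    by_cases hpos : 0 < ℓ (y F)
    · exact hside 1 F F' (by simpa using hpos) (by simpa using h.mp hpos)
    · have hpos' : ¬ 0 < ℓ (y F') := fun h' => hpos (h.mpr h')
      refine hside (-1) F F' ?_ ?_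
      · linarith [(hy0 F).lt_of_le (not_lt.1 hpos)]
      · linarith [(hy0 F').lt_of_le (not_lt.1 hpos')]
  exact Finite.of_injective _ hinj

end Drawings

/-! ### Averaging systems -/

section Averaging

variable {P : Finset Plane}

/-- `μ` expresses each point of `S` as a nontrivial convex combination of points of `P`. -/
structure IsAveraging (S : P → Prop) (μ : P → P → ℝ) : Prop where
  nonneg : ∀ p q, 0 ≤ μ p q
  sum_eq_one : ∀ p, S p → ∑ q, μ p q = 1
  sum_smul_eq : ∀ p, S p → ∑ q, μ p q • (q : Plane) = p
  self_eq_zero : ∀ p, S p → μ p p = 0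

variable {S : P → Prop} {μ : P → P → ℝ}

/-- The maximum principle: a subharmonic function attains its maximum at a boundary point. -/
theorem IsAveraging.nonpos (hμ : IsAveraging S μ) {h : P → ℝ}
    (hsub : ∀ p, S p → h p ≤ ∑ q, μ p q * h q) (hbdry : ∀ p, ¬ S p → h p ≤ 0) (p : P) :
    h p ≤ 0 := by
  obtain ⟨p₀, -, hp₀⟩ := Finset.exists_max_image Finset.univ h ⟨p, Finset.mem_univ p⟩
  refine (hp₀ p (Finset.mem_univ p)).trans ?_
  by_contra! hpos
  -- A maximiser of largest norm cannot be an average of other maximisers.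
  obtain ⟨a, ha, hmax⟩ := Finset.exists_max_image
    (Finset.univ.filter fun q => h q = h p₀) (fun q : P => ‖(q : Plane)‖) ⟨p₀, by simp⟩
  simp only [Finset.mem_filter, Finset.mem_univ, true_and] at ha hmax
  have haS : S a := by
    by_contra hn
    linarith [hbdry a hn]
  have hsum := hμ.sum_eq_one a haS
  -- A weighted mean reaches the maximum only if all weight sits on maximisers.
  have hz : ∀ q, μ a q * (h p₀ - h q) = 0 := by
    have h0 : ∀ q ∈ Finset.univ, 0 ≤ μ a q * (h p₀ - h q) := fun q hq =>
      mul_nonneg (hμ.nonneg a q) (sub_nonneg.2 (hp₀ q hq))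
    have h1 : ∑ q, μ a q * (h p₀ - h q) = 0 := by
      refine le_antisymm ?_ (Finset.sum_nonneg h0)
      simp only [mul_sub, Finset.sum_sub_distrib, ← Finset.sum_mul, hsum]
      linarith [hsub a haS]
    exact fun q => (Finset.sum_eq_zero_iff_of_nonneg h0).1 h1 q (Finset.mem_univ q)
  -- As `a` is the barycentre, the variance is the mean of `‖q‖ ^ 2` minus `‖a‖ ^ 2`, which is at
  -- most 0 by the choice of `a`. So all weight would sit at `a` itself, where it is zero.
  have hz' : ∀ q, μ a q * (‖(q : Plane) - a‖ ^ 2) = 0 := by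
    have h0 : ∀ q ∈ Finset.univ, 0 ≤ μ a q * (‖(q : Plane) - a‖ ^ 2) := fun q _ =>
      mul_nonneg (hμ.nonneg a q) (by positivity)
    have h1 : ∑ q, μ a q * (‖(q : Plane) - a‖ ^ 2) ≤ 0 := by
      have hin : ∑ q, μ a q * inner ℝ (q : Plane) (a : Plane) = ‖(a : Plane)‖ ^ 2 := by
        rw [← real_inner_self_eq_norm_sq]
        nth_rw 2 [← hμ.sum_smul_eq a haS]
        simp only [sum_inner, real_inner_smul_left]
      have hle : ∑ q, μ a q * ‖(q : Plane)‖ ^ 2 ≤ ∑ q, μ a q * ‖(a : Plane)‖ ^ 2 := by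
        refine Finset.sum_le_sum fun q _ => ?_
        rcases mul_eq_zero.1 (hz q) with h | h
        · simp [h]
        · have := hmax q (by linarith)
          have := hμ.nonneg a q
          gcongr
      have hexp : ∀ q : P, μ a q * (‖(q : Plane) - a‖ ^ 2) = μ a q * ‖(q : Plane)‖ ^ 2 -
          2 * (μ a q * inner ℝ (q : Plane) (a : Plane)) + μ a q * ‖(a : Plane)‖ ^ 2 := by
        intro q
        rw [norm_sub_sq_real]
        ring
      simp only [hexp, Finset.sum_add_distrib, Finset.sum_sub_distrib, ← Finset.mul_sum, hin]
      rw [← Finset.sum_mul, hsum] at hle ⊢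
      linarith
    exact fun q => (Finset.sum_eq_zero_iff_of_nonneg h0).1
      (le_antisymm h1 (Finset.sum_nonneg h0)) q (Finset.mem_univ q)
  have hall : ∀ q, μ a q = 0 := by
    intro q
    by_cases hq : q = a
    · rw [hq]
      exact hμ.self_eq_zero a haS
    · refine (mul_eq_zero.1 (hz' q)).resolve_right ?_
      have : (q : Plane) - a ≠ 0 := sub_ne_zero.2 fun h => hq (Subtype.ext h)
      positivity
  simp [hall] at hsum

/-- Two harmonic functions with the same boundary values agree. -/
theorem IsAveraging.eq_of_boundary_eq (hμ : IsAveraging S μ) {h h' : P → ℝ}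
    (hh : ∀ p, S p → h p = ∑ q, μ p q * h q) (hh' : ∀ p, S p → h' p = ∑ q, μ p q * h' q)
    (hbdry : ∀ p, ¬ S p → h p = h' p) : h = h' := by
  have key : ∀ g g' : P → ℝ, (∀ p, S p → g p = ∑ q, μ p q * g q) →
      (∀ p, S p → g' p = ∑ q, μ p q * g' q) → (∀ p, ¬ S p → g p = g' p) → ∀ p, g p ≤ g' p := by
    intro g g' hg hg' hb p
    refine sub_nonpos.1 (hμ.nonpos (h := fun p => g p - g' p) (fun p hp => ?_)
      (fun p hp => (sub_eq_zero.2 (hb p hp)).le) p)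
    simp only [mul_sub, Finset.sum_sub_distrib]
    rw [← hg p hp, ← hg' p hp]
  exact funext fun p => le_antisymm (key h h' hh hh' hbdry p)
    (key h' h hh' hh (fun p hp => (hbdry p hp).symm) p)

open Classical in
/-- There is a harmonic function with any prescribed boundary values. -/
theorem IsAveraging.exists_harmonic (hμ : IsAveraging S μ) (b : P → ℝ) :
    ∃ h : P → ℝ, (∀ p, S p → h p = ∑ q, μ p q * h q) ∧ ∀ p, ¬ S p → h p = b p := by
  let L : (P → ℝ) →ₗ[ℝ] (P → ℝ) :=
    { toFun := fun h p => if S p then h p - ∑ q, μ p q * h q else h p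
      map_add' := by
        intro h h'
        ext p
        by_cases hp : S p
        · simp only [hp, if_true, Pi.add_apply, mul_add, Finset.sum_add_distrib]
          ring
        · simp [hp]
      map_smul' := by
        intro c h
        ext p
        by_cases hp : S p
        · simp only [hp, if_true, Pi.smul_apply, smul_eq_mul, RingHom.id_apply, mul_sub,
            Finset.mul_sum]
          congr 1
          exact Finset.sum_congr rfl fun q _ => by ring
        · simp [hp] }
  have hLS : ∀ h p, S p → L h p = h p - ∑ q, μ p q * h q := fun h p hp => if_pos hp
  have hLn : ∀ h p, ¬ S p → L h p = h p := fun h p hp => if_neg hp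
  -- Uniqueness makes the square linear system injective, hence solvable.
  have hinj : Function.Injective L := by
    rw [← LinearMap.ker_eq_bot, LinearMap.ker_eq_bot']
    intro h hh
    refine hμ.eq_of_boundary_eq (h' := 0) (fun p hp => ?_) (fun p _ => by simp) fun p hp => ?_
    · rw [← sub_eq_zero, ← hLS h p hp, hh]; rfl
    · rw [← hLn h p hp, hh]
  obtain ⟨h, hh⟩ := LinearMap.injective_iff_surjective.1 hinj fun p => if S p then 0 else b p
  refine ⟨h, fun p hp => ?_, fun p hp => ?_⟩
  · rw [← sub_eq_zero, ← hLS h p hp]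
    exact (congrFun hh p).trans (if_pos hp)
  · rw [← hLn h p hp]
    exact (congrFun hh p).trans (if_neg hp)

end Averaging

/-! ### The corners of a pseudo-triangle -/

/-- A hull with interior points spans the plane, and three points spanning a plane are independent.
-/
theorem affineIndependent_of_nonempty_interior {s : Set Plane} {ι : Type*} [Fintype ι]
    (hι : Fintype.card ι = 3) (v : ι → Plane) (hs : (interior s).Nonempty)
    (h : s ⊆ convexHull ℝ (range v)) :
    AffineIndependent ℝ v ∧ affineSpan ℝ (range v) = ⊤ := by
  have htop : affineSpan ℝ (range v) = ⊤ := by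
    rw [← interior_convexHull_nonempty_iff_affineSpan_eq_top]
    exact hs.mono (interior_mono h)
  refine ⟨?_, htop⟩
  rw [affineIndependent_iff_finrank_vectorSpan_eq ℝ _ (n := 2) hι,
    ← direction_affineSpan, htop, AffineSubspace.direction_top, finrank_top]
  simp

namespace PseudoTriangulation

variable {Q : Pointgon} (T : PseudoTriangulation Q)

/-- `K` is the set of corners of the pseudo-triangle `F`. -/
structure IsCornerSet (F : Set Plane) (K : Finset Q.points) : Prop where
  affineIndependent : AffineIndependent ℝ (fun k : K => ((k : Q.points) : Plane))
  affineSpan_eq_top : affineSpan ℝ (range fun k : K => ((k : Q.points) : Plane)) = ⊤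
  mem_closure : ∀ k ∈ K, (k : Plane) ∈ closure F
  not_isReflexAngle : ∀ k ∈ K, ¬ IsReflexAngle F k
  isReflexAngle : ∀ p : Q.points, (p : Plane) ∈ closure F → p ∉ K → IsReflexAngle F p
  mem_convexHull : ∀ p : Q.points, (p : Plane) ∈ closure F →
    (p : Plane) ∈ convexHull ℝ ((fun k : Q.points => (k : Plane)) '' K)

theorem vertex_mem_drawing (p : Q.points) : (p : Plane) ∈ drawing T.graph :=
  mem_drawing_iff.2 (Or.inl p.2)

variable {T}

/-- Faces avoid the drawing and no vertex lies inside an edge, so the points of `Q.points` in the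
closure of `F` are exactly the vertices of its bounding polygon. -/
theorem exists_isCornerSet (hT : T.NoStraightAngles) {F : Set Plane} (hF : F ∈ T.faces) :
    ∃ K : Finset Q.points, IsCornerSet F K := by
  classical
  obtain ⟨n, q, hadj, hsimple, hint, hcard⟩ := T.isPseudoTriangle F hF
  set C : Polygon Plane n := ⟨fun i => (q i : Plane)⟩ with hC
  have hn : 0 < n := by have := hsimple.three_le; omega
  have hqinj : Function.Injective q := fun i j h =>
    hsimple.injective (congrArg Subtype.val h : (q i : Plane) = q j)
  have hvert : ∀ i, (q i : Plane) ∈ closure F := fun i => frontier_subset_closure <| by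
    rw [hint.frontier_eq, boundary_eq_iUnion_segment]
    exact mem_iUnion.2 ⟨i, left_mem_segment ℝ _ _⟩
  have hmem : ∀ p : Q.points, (p : Plane) ∈ closure F → ∃ i, p = q i := by
    intro p hp
    have h := mem_frontier_of_mem_drawing hF (T.vertex_mem_drawing p) hp
    rw [hint.frontier_eq, boundary_eq_iUnion_segment] at h
    obtain ⟨i, hi⟩ := mem_iUnion.1 h
    rcases mem_vertices_of_mem_segment T.isPlane (hadj i) hi with h | h
    · exact ⟨_, h⟩
    · exact ⟨_, h⟩
  set K : Finset Q.points := (Finset.univ.filter fun i => IsConvexAngle F (q i)).image q with hK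
  have hKmem : ∀ i, q i ∈ K ↔ IsConvexAngle F (q i) := by
    intro i
    simp [hK, hqinj.eq_iff]
  have hKcard : K.card = 3 := by
    rw [hK, Finset.card_image_of_injective _ hqinj, ← hcard, ← Set.ncard_coe_finset]
    congr 1
    ext i
    simp
  have hKimg : (fun k : Q.points => (k : Plane)) '' K =
      C.vertices '' {i | IsConvexAngle F (C i)} := by
    rw [hK, Finset.coe_image, ← Set.image_comp]
    congr 1
    ext i
    simp [hC]
  have hull : convexHull ℝ (range C.vertices) ⊆
      convexHull ℝ ((fun k : Q.points => (k : Plane)) '' K) := by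
    rw [hKimg]
    exact hint.convexHull_corners hn
  have hrange : (range fun k : K => ((k : Q.points) : Plane)) =
      (fun k : Q.points => (k : Plane)) '' K := by
    rw [image_eq_range]
    rfl
  have hindep := affineIndependent_of_nonempty_interior (s := F) (ι := K)
    (by rw [Fintype.card_coe, hKcard]) (fun k => ((k : Q.points) : Plane))
    (by rw [hint.isOpen.interior_eq]; exact hint.isConnected.nonempty)
    (by rw [hrange]; exact (hint.subset_convexHull hn).trans hull)
  refine ⟨K, ⟨hindep.1, hindep.2, ?_, ?_, ?_, ?_⟩⟩
  · intro k hk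
    obtain ⟨i, -, rfl⟩ := Finset.mem_image.1 hk
    exact hvert i
  · intro k hk h
    obtain ⟨i, -, rfl⟩ := Finset.mem_image.1 hk
    exact lt_asymm h ((hKmem i).1 hk)
  · intro p hp hpK
    obtain ⟨i, rfl⟩ := hmem p hp
    rw [hKmem] at hpK
    -- Excluding straight angles turns "not convex" into "reflex".
    exact lt_of_le_of_ne (not_lt.1 hpK) fun h => hT F hF (q i) h.symm
  · intro p hp
    obtain ⟨i, rfl⟩ := hmem p hp
    exact hull (subset_convexHull ℝ _ ⟨i, rfl⟩)

theorem IsCornerSet.exists_affineMap {F : Set Plane} {K : Finset Q.points} (h : IsCornerSet F K)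
    (g : Q.points → ℝ) : ∃ A : Plane →ᵃ[ℝ] ℝ, ∀ k ∈ K, A k = g k := by
  let b : AffineBasis K ℝ Plane := ⟨fun k => (k : Q.points), h.affineIndependent,
    h.affineSpan_eq_top⟩
  refine ⟨∑ k : K, g k • b.coord k, fun k hk => ?_⟩
  have h1 : ((k : Q.points) : Plane) = b ⟨k, hk⟩ := rfl
  rw [h1]
  classical
  have h2 : ∀ (s : Finset K) (x : Plane), (∑ k ∈ s, g k • b.coord k) x =
      ∑ k ∈ s, g k * b.coord k x := by
    intro s x
    induction s using Finset.induction_on with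
    | empty => simp
    | insert a s ha ih => simp [Finset.sum_insert ha, ih]
  rw [h2, Finset.sum_eq_single ⟨k, hk⟩]
  · simp
  · intro j _ hj
    rw [b.coord_apply_ne hj, mul_zero]
  · simp

theorem IsCornerSet.affineMap_ext {F : Set Plane} {K : Finset Q.points} (h : IsCornerSet F K)
    {A B : Plane →ᵃ[ℝ] ℝ} (hAB : ∀ k ∈ K, A k = B k) : A = B := by
  refine AffineMap.ext_on (s := range fun k : K => ((k : Q.points) : Plane))
    h.affineSpan_eq_top ?_
  rintro _ ⟨k, rfl⟩
  exact hAB k k.2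

end PseudoTriangulation
end PseudoTri

namespace PseudoTri
namespace PseudoTriangulation

variable {Q : Pointgon} {T : PseudoTriangulation Q}

/-! ### The closed faces cover the region -/

theorem exists_edge_of_mem_frontier {F : Set Plane} (hF : F ∈ T.faces) {x : Plane}
    (hx : x ∈ frontier F) : ∃ u v : Q.points, T.graph.Adj u v ∧ (u : Plane) ∈ closure F ∧
      (v : Plane) ∈ closure F ∧ x ∈ segment ℝ (u : Plane) v := by
  obtain ⟨n, q, hadj, -, hint, -⟩ := T.isPseudoTriangle F hF
  have hfr := hint.frontier_eq
  rw [boundary_eq_iUnion_segment] at hfr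
  rw [hfr] at hx
  obtain ⟨i, hi⟩ := mem_iUnion.1 hx
  have hsub : segment ℝ (q i : Plane) (q (finRotate n i)) ⊆ closure F :=
    Subset.trans (fun y hy => hfr ▸ mem_iUnion.2 ⟨i, hy⟩) frontier_subset_closure
  exact ⟨q i, q (finRotate n i), hadj i, hsub (left_mem_segment ℝ _ _),
    hsub (right_mem_segment ℝ _ _), hi⟩

variable (T) in
theorem finite_faces : T.faces.Finite := by
  have hfin : (⋃ (u : Q.points) (v : Q.points) (_ : T.graph.Adj u v),
      {F ∈ T.faces | midpoint ℝ (u : Plane) v ∈ closure F}).Finite :=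
    finite_iUnion fun u => finite_iUnion fun v => finite_iUnion fun h =>
      finite_facesIn_midpoint_mem_closure T.isPlane h
  refine hfin.subset fun F hF => ?_
  obtain ⟨n, q, hadj, hsimple, hint, -⟩ := T.isPseudoTriangle F hF
  have hn : 0 < n := by have := hsimple.three_le; omega
  refine mem_iUnion.2 ⟨q ⟨0, hn⟩, mem_iUnion.2 ⟨_, mem_iUnion.2 ⟨hadj ⟨0, hn⟩, hF, ?_⟩⟩⟩
  refine frontier_subset_closure ?_
  rw [hint.frontier_eq, boundary_eq_iUnion_segment]
  exact mem_iUnion.2 ⟨⟨0, hn⟩, midpoint_mem_segment _ _⟩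

variable (T) in
-- The faces cover a dense part of the interior, and a finite union of closures is closed.
theorem exists_face_mem_closure {x : Plane} (hx : x ∈ Q.region) : ∃ F ∈ T.faces, x ∈ closure F := by
  have hsub : Q.region ⊆ ⋃ F ∈ T.faces, closure F := by
    refine closure_minimal ((dense_compl_drawing (G := T.graph)).open_subset_closure_inter
      Q.isInterior.isOpen |>.trans (closure_minimal (fun y hy => ?_) ?_))
      (T.finite_faces.isClosed_biUnion fun _ _ => isClosed_closure)
    · exact mem_iUnion₂.2 ⟨_, ⟨y, hy, rfl⟩, subset_closure (mem_connectedComponentIn hy.2)⟩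
    · exact T.finite_faces.isClosed_biUnion fun _ _ => isClosed_closure
  simpa using hsub hx

/-! ### The averaging system of a pseudo-triangulation -/

variable {K : Set Plane → Finset Q.points}

/-- `μ` expresses each pointed vertex as a convex combination of the corners of the face in which
it is reflex. -/
structure IsCornerAveraging (T : PseudoTriangulation Q) (K : Set Plane → Finset Q.points)
    (μ : Q.points → Q.points → ℝ) : Prop extends IsAveraging T.IsRPointed μ where
  eq_zero : ∀ F ∈ T.faces, ∀ p : Q.points, IsReflexAngle F p → ∀ q ∉ K F, μ p q = 0

theorem exists_isCornerAveraging (hK : ∀ F ∈ T.faces, IsCornerSet F (K F)) :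
    ∃ μ, IsCornerAveraging T K μ := by
  classical
  have key : ∀ p : Q.points, ∃ m : Q.points → ℝ, (∀ q, 0 ≤ m q) ∧ (T.IsRPointed p →
      ∑ q, m q = 1 ∧ ∑ q, m q • (q : Plane) = p ∧ m p = 0 ∧
      ∀ F ∈ T.faces, IsReflexAngle F p → ∀ q ∉ K F, m q = 0) := by
    intro p
    by_cases hp : T.IsRPointed p
    swap
    · exact ⟨0, fun _ => le_rfl, fun h => (hp h).elim⟩
    obtain ⟨F, hF, hr⟩ := hp
    have hmem := (hK F hF).mem_convexHull p (mem_closure_of_isReflexAngle hr)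
    have hpK : p ∉ K F := fun h => (hK F hF).not_isReflexAngle p h hr
    rw [← Finset.coe_image, Finset.mem_convexHull'] at hmem
    obtain ⟨w, hw0, hw1, hw⟩ := hmem
    rw [Finset.sum_image Subtype.val_injective.injOn] at hw1 hw
    refine ⟨fun q => if q ∈ K F then w q else 0, fun q => ?_, fun _ => ⟨?_, ?_, if_neg hpK, ?_⟩⟩
    · dsimp only
      split_ifs with h
      · exact hw0 _ (Finset.mem_image_of_mem _ h)
      · exact le_rfl
    · rw [← hw1, Finset.sum_ite_mem, Finset.univ_inter]
    · simp only [ite_smul, zero_smul]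
      rw [Finset.sum_ite_mem, Finset.univ_inter, hw]
    · intro F' hF' hr' q hq
      -- The weights do not depend on the face chosen, because the reflex face of `p` is unique.
      rw [eq_of_isReflexAngle T.isPlane hF' hF p hr' hr] at hq
      exact if_neg hq
  choose μ hμ0 hμ using key
  exact ⟨μ, ⟨⟨hμ0, fun p hp => (hμ p hp).1, fun p hp => (hμ p hp).2.1,
    fun p hp => (hμ p hp).2.2.1⟩, fun F hF p hr => (hμ p ⟨F, hF, hr⟩).2.2.2 F hF hr⟩⟩

variable {μ : Q.points → Q.points → ℝ}

theorem IsCornerAveraging.affineMap_apply (hμ : IsCornerAveraging T K μ) (A : Plane →ᵃ[ℝ] ℝ)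
    {p : Q.points} (hp : T.IsRPointed p) : A p = ∑ q, μ p q * A q := by
  have h : ∀ x : Plane, A x = A.linear x + A 0 := fun x => congrFun A.decomp x
  calc A p = ∑ q, μ p q * A.linear q + (∑ q, μ p q) * A 0 := by
        rw [h p, ← hμ.sum_smul_eq p hp, map_sum, hμ.sum_eq_one p hp, one_mul]
        simp
    _ = ∑ q, μ p q * A q := by
        rw [Finset.sum_mul, ← Finset.sum_add_distrib]
        exact Finset.sum_congr rfl fun q _ => by rw [h q]; ring

/-- The vertex heights of a lifting are harmonic. -/
theorem IsCornerAveraging.harmonic_of_isLifting (hK : ∀ F ∈ T.faces, IsCornerSet F (K F))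
    (hμ : IsCornerAveraging T K μ) {f : Q.region → ℝ} (hf : T.IsLifting f) {p : Q.points}
    (hp : T.IsRPointed p) : f (Q.toRegion p) = ∑ q, μ p q * f (Q.toRegion q) := by
  obtain ⟨F, hF, hr⟩ := hp
  obtain ⟨A, hA⟩ := hf.2 F hF
  rw [hA (Q.toRegion p) (mem_closure_of_isReflexAngle hr)]
  refine (hμ.affineMap_apply A ⟨F, hF, hr⟩).trans (Finset.sum_congr rfl fun q _ => ?_)
  by_cases hq : q ∈ K F
  · rw [hA (Q.toRegion q) ((hK F hF).mem_closure q hq)]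
    rfl
  · rw [hμ.eq_zero F hF p hr q hq, zero_mul, zero_mul]

/-! ### Liftings and vertex heights -/

/-- A lifting is determined by its vertex heights. -/
theorem IsLifting.ext_of_vertices (hK : ∀ F ∈ T.faces, IsCornerSet F (K F)) {f g : Q.region → ℝ}
    (hf : T.IsLifting f) (hg : T.IsLifting g)
    (h : ∀ p : Q.points, f (Q.toRegion p) = g (Q.toRegion p)) : f = g := by
  ext x
  obtain ⟨F, hF, hx⟩ := T.exists_face_mem_closure x.2
  obtain ⟨A, hA⟩ := hf.2 F hF
  obtain ⟨B, hB⟩ := hg.2 F hF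
  have hAB : A = B := (hK F hF).affineMap_ext fun k hk => by
    have hk' := (hK F hF).mem_closure k hk
    exact (hA (Q.toRegion k) hk').symm.trans ((h k).trans (hB (Q.toRegion k) hk'))
  rw [hA x hx, hB x hx, hAB]

/-- Affine functions on the faces that have common values at the vertices agree on the
intersections of the closed faces. -/
theorem affineMap_eq_of_mem_closure {A : Set Plane → Plane →ᵃ[ℝ] ℝ} {h : Q.points → ℝ}
    (hA : ∀ F ∈ T.faces, ∀ p : Q.points, (p : Plane) ∈ closure F → A F p = h p)
    {F F' : Set Plane} (hF : F ∈ T.faces) (hF' : F' ∈ T.faces) {x : Plane} (hx : x ∈ closure F)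
    (hx' : x ∈ closure F') : A F x = A F' x := by
  by_cases hne : F = F'
  · rw [hne]
  by_cases hxP : x ∈ Q.points
  · exact (hA F hF ⟨x, hxP⟩ hx).trans (hA F' hF' ⟨x, hxP⟩ hx').symm
  obtain ⟨u, v, huv, hu, hv, hxuv⟩ :=
    exists_edge_of_mem_frontier hF (mem_frontier_of_mem_closure_inter hF hF' hne hx hx')
  obtain ⟨u', v', huv', hu', hv', hxuv'⟩ := exists_edge_of_mem_frontier hF'
    (mem_frontier_of_mem_closure_inter hF' hF (Ne.symm hne) hx' hx)
  have hopen : ∀ {a b : Q.points}, x ∈ segment ℝ (a : Plane) b → x ∈ openSegment ℝ (a : Plane) b :=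
    fun {a b} hab => mem_openSegment_of_ne_left_right (fun e => hxP (e ▸ a.2))
      (fun e => hxP (e ▸ b.2)) hab
  -- The point is interior to an edge of each face. In a plane graph these edges coincide, and the
  -- endpoint heights determine both affine maps along the edge.
  have hedge : s(u, v) = s(u', v') := by
    by_contra hs
    exact Set.disjoint_left.1 (T.isPlane.edges_disjoint u v u' v' huv huv' hs) (hopen hxuv)
      (hopen hxuv')
  have huv₂ : (u : Plane) ∈ closure F' ∧ (v : Plane) ∈ closure F' := by
    rcases Sym2.eq_iff.1 hedge with ⟨rfl, rfl⟩ | ⟨rfl, rfl⟩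
    · exact ⟨hu', hv'⟩
    · exact ⟨hv', hu'⟩
  rw [segment_eq_image_lineMap] at hxuv
  obtain ⟨t, -, rfl⟩ := hxuv
  rw [AffineMap.apply_lineMap, AffineMap.apply_lineMap, hA F hF u hu, hA F hF v hv,
    hA F' hF' u huv₂.1, hA F' hF' v huv₂.2]

/-- Harmonic vertex heights extend to a lifting. -/
theorem IsCornerAveraging.exists_isLifting (hK : ∀ F ∈ T.faces, IsCornerSet F (K F))
    (hμ : IsCornerAveraging T K μ) {h : Q.points → ℝ}
    (hh : ∀ p, T.IsRPointed p → h p = ∑ q, μ p q * h q) :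
    ∃ f, T.IsLifting f ∧ ∀ p : Q.points, f (Q.toRegion p) = h p := by
  have hex : ∀ F : Set Plane, ∃ A : Plane →ᵃ[ℝ] ℝ, F ∈ T.faces → ∀ k ∈ K F, A k = h k := by
    intro F
    by_cases hF : F ∈ T.faces
    · obtain ⟨A, hA⟩ := (hK F hF).exists_affineMap h
      exact ⟨A, fun _ => hA⟩
    · exact ⟨0, fun h => (hF h).elim⟩
  choose A hA using hex
  have hvert : ∀ F ∈ T.faces, ∀ p : Q.points, (p : Plane) ∈ closure F → A F p = h p := by
    intro F hF p hp
    -- A non-corner vertex is reflex in `F`, so its averaging equation is the one satisfied by the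
    -- affine map through the corners of `F`.
    by_cases hpK : p ∈ K F
    · exact hA F hF p hpK
    have hr := (hK F hF).isReflexAngle p hp hpK
    rw [hh p ⟨F, hF, hr⟩, hμ.affineMap_apply (A F) ⟨F, hF, hr⟩]
    refine Finset.sum_congr rfl fun q _ => ?_
    by_cases hq : q ∈ K F
    · rw [hA F hF q hq]
    · rw [hμ.eq_zero F hF p hr q hq, zero_mul, zero_mul]
  choose Φ hΦ hΦmem using fun x : Q.region => T.exists_face_mem_closure x.2
  have hval : ∀ F ∈ T.faces, ∀ x : Q.region, (x : Plane) ∈ closure F → A (Φ x) x = A F x :=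
    fun F hF x hx => affineMap_eq_of_mem_closure hvert (hΦ x) hF (hΦmem x) hx
  refine ⟨fun x => A (Φ x) x, ⟨?_, fun F hF => ⟨A F, hval F hF⟩⟩, fun p =>
    hvert _ (hΦ _) p (hΦmem (Q.toRegion p))⟩
  have : Finite T.faces := T.finite_faces
  refine (locallyFinite_of_finite fun F : T.faces =>
    ((↑) : Q.region → Plane) ⁻¹' closure (F : Set Plane)).continuous ?_ ?_ ?_
  · exact eq_univ_of_forall fun x => mem_iUnion.2 ⟨⟨Φ x, hΦ x⟩, hΦmem x⟩
  · exact fun F => isClosed_closure.preimage continuous_subtype_val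
  · intro F
    refine ContinuousOn.congr (f := fun x : Q.region => A F x) ?_ fun x hx => hval F F.2 x hx
    exact ((A F).continuous_of_finiteDimensional.comp continuous_subtype_val).continuousOn

end PseudoTriangulation
end PseudoTri

/-! ### The Surface Theorem: liftings as solutions of the Dirichlet problem -/

theorem mainTheorem5 (Q : PseudoTri.Pointgon) (T : PseudoTri.PseudoTriangulation Q)
    (hT : T.NoStraightAngles) :
    (∀ h : T.RNonPointed → ℝ,
      ∃! f : Q.region → ℝ, T.IsLifting f ∧ ∀ w : T.RNonPointed, f w.pt = h w) ∧
    (∃ c : T.RPointed → T.RNonPointed → ℝ, (∀ p w, 0 ≤ c p w) ∧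
      ∀ f : Q.region → ℝ, T.IsLifting f →
        ∀ p : T.RPointed, f p.pt = ∑ w : T.RNonPointed, c p w * f w.pt) ∧
    (Module.Finite ℝ T.liftings ∧
      Module.finrank ℝ T.liftings = Fintype.card T.RNonPointed) := by
  classical
  have hex : ∀ F : Set PseudoTri.Plane, ∃ K : Finset Q.points, F ∈ T.faces →
      PseudoTri.PseudoTriangulation.IsCornerSet F K := by
    intro F
    by_cases hF : F ∈ T.faces
    · obtain ⟨K, hK⟩ := PseudoTri.PseudoTriangulation.exists_isCornerSet hT hF
      exact ⟨K, fun _ => hK⟩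
    · exact ⟨∅, fun h => (hF h).elim⟩
  choose K hK using hex
  obtain ⟨μ, hμ⟩ := PseudoTri.PseudoTriangulation.exists_isCornerAveraging hK
  have hunique : ∀ h : T.RNonPointed → ℝ,
      ∃! f : Q.region → ℝ, T.IsLifting f ∧ ∀ w : T.RNonPointed, f w.pt = h w := by
    intro h
    obtain ⟨g, hg, hgb⟩ := hμ.exists_harmonic
      fun p => if hp : T.IsRPointed p then 0 else h (Subtype.mk p hp)
    obtain ⟨f, hf, hfg⟩ := hμ.exists_isLifting hK hg
    refine ⟨f, ⟨hf, fun w => ?_⟩, fun f' ⟨hf', hfb'⟩ => ?_⟩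
    · exact (hfg w.1).trans ((hgb w.1 w.2).trans (dif_neg w.2))
    · refine hf'.ext_of_vertices hK hf fun p => ?_
      rw [hfg p]
      refine congrFun (hμ.eq_of_boundary_eq (h := fun p => f' (Q.toRegion p))
        (fun p hp => hμ.harmonic_of_isLifting hK hf' hp) hg fun p hp => ?_) p
      exact (hfb' (Subtype.mk p hp)).trans ((hgb p hp).trans (dif_neg hp)).symm
  refine ⟨hunique, ?_, ?_⟩
  -- The coefficients are harmonic measures: `g w` extends the indicator of `w`. They are
  -- nonnegative by the maximum principle for `-g w`, and superposition reproduces the heights of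
  -- every lifting.
  · choose g hg hgb using fun w : T.RNonPointed =>
      hμ.exists_harmonic fun p => if p = w.1 then 1 else 0
    refine ⟨fun p w => g w p.1, fun p w => ?_, fun f hf p => ?_⟩
    · refine neg_nonpos.1 (hμ.nonpos (h := fun p => -g w p) (fun p hp => ?_) (fun p hp => ?_) p.1)
      · simp only [mul_neg, Finset.sum_neg_distrib]
        rw [← hg w p hp]
      · rw [hgb w p hp]
        split_ifs <;> norm_num
    · refine congrFun (hμ.eq_of_boundary_eq (h := fun p => f (Q.toRegion p))
        (h' := fun p => ∑ w : T.RNonPointed, g w p * f w.pt)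
        (fun p hp => hμ.harmonic_of_isLifting hK hf hp) (fun p hp => ?_) fun p hp => ?_) p.1
      · simp only [Finset.mul_sum]
        rw [Finset.sum_comm]
        refine Finset.sum_congr rfl fun w _ => ?_
        rw [hg w p hp, Finset.sum_mul]
        exact Finset.sum_congr rfl fun q _ => by ring
      · obtain ⟨w₀, rfl⟩ : ∃ w : T.RNonPointed, w.1 = p := ⟨Subtype.mk p hp, rfl⟩
        rw [Finset.sum_eq_single w₀]
        · rw [hgb _ _ hp, if_pos rfl, one_mul]
          rfl
        · intro w _ hw
          rw [hgb w _ hp, if_neg fun h => hw (Subtype.ext h.symm), zero_mul]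
        · simp
  · let ev : T.liftings →ₗ[ℝ] (T.RNonPointed → ℝ) :=
      { toFun := fun f w => f.1 w.pt
        map_add' := fun _ _ => rfl
        map_smul' := fun _ _ => rfl }
    have hbij : Function.Bijective ev := by
      refine ⟨fun f f' h => Subtype.ext ?_, fun h => ?_⟩
      · exact (hunique (ev f)).unique ⟨f.2, fun _ => rfl⟩ ⟨f'.2, fun w => (congrFun h w).symm⟩
      · obtain ⟨f, ⟨hf, hfb⟩, -⟩ := hunique h
        exact ⟨⟨f, hf⟩, funext hfb⟩
    let e := LinearEquiv.ofBijective ev hbij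
    exact ⟨Module.Finite.equiv e.symm, by rw [e.finrank_eq, Module.finrank_fintype_fun_eq_card]⟩
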